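/- **Setting.** Fix a function-free first-order vocabulary with constants, predicates, and a distinguished unary predicate $sp$. Given a finite non-empty set $O$ of objects and an interpretation of the constants in $O$, a state $s$ assigns truth values to all ground atoms over $O$. An open expression is a finite decision diagram whose inner nodes are labelled by atoms (including equalities) over variables and constants, with real leaves; it has a value for each state and each assignment of its variables. A closed expression is $\max_{x_1,\dots,x_k}\operatorname{avg}_y V(x,y)$ with $k\ge 0$, a single variable $y$ and $V(x,y)$ open; it is a function of the state. A service domain consists of: (i) a finite non-empty list of agent action templates $A(x)$, each with finitely many deterministic variants $A_j(x)$; (ii) finitely many variants $E_j(i)$ of an exogenous action $E(i)$ centred at an object $i$; (iii) for each variant, a choice probability, which is an open expression in the action's parameters, and, for each predicate $p$, a truth value diagram, a $0/1$-valued open expression in the parameters and the arguments $y$ of $p(y)$, which gives the truth value of $p(y)$ in the next state; in every state and for all parameters the choice probabilities of the variants of an action are non-negative and sum to $1$; (iv) a reward $R=\max_x\operatorname{avg}_y R(x,y)$, which is a closed expression, and a discount factor $\gamma\in[0,1)$. For each $O$ this defines an MDP: the agent picks a ground action $A(o)$; a variant is drawn and executed; then, in the resulting state, a variant of $E(i)$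 is drawn independently for each $i\in O$, and all of them are applied simultaneously. Let $T[V](s)=\max_{a}\{R(s)+\gamma\sum_{s'}\Pr(s'\mid s,a)V(s')\}$, and let $V^*(s)$ be the supremum over policies of the expected discounted total reward from $s$. **Assumptions.** * A1 (object-centred, non-interfering events): in the choice probabilities and truth value diagrams of $E_j(i)$, the predicate $sp$ occurs only as $sp(i)$, except that the diagram for $sp(y)$ may also contain $sp(y)$. (Given A2, it follows that simultaneous application of all $E(i)$ is equivalent to sequential application in any order.) * A2: executing $E_j(i)$ changes no truth value other than that of $sp(i)$. * A3: $sp$ does not occur in the choice probabilities and truth value diagrams of agent actions, except that the diagram for $sp(y)$ may contain $sp(y)$. * A4: in $R(x,y)$ the predicate $sp$ occurs only as $sp(y)$. * Non-negative reward: $R(x,y)\ge 0$ in every state and for all values of $x,y$. **Template method.** Regression $\mathrm{Regr}(V,B)$ of an open expression over a variant $B$ replaces every atom by its truth value diagram under $B$. $SDP^2$ maps $\max_x\operatorname{avg}_y V(x,y)$ to $\max_x\operatorname{avg}_y W(x,y)$, where $W(x,a)=\sum_j \Pr(E_j(a))\cdot \mathrm{Regr}(V(x,a),E_j(a))$ for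 a new constant $a$; the variables $x$ are shared by all summands. $SDP^1(V)$ forms, for each action template, $Q^{A(u)}=R\oplus\gamma\,[\oplus_j \Pr(A_j(u))\cdot\mathrm{Regr}(V,A_j(u))]$, where the maximization variables of all summands are renamed apart and $y$ is shared, then turns the parameters $u$ into maximization variables, and then takes the maximum over the action templates by iterating the binary operation that maps $\max_x\operatorname{avg}_y f^1(x,y)$ and $\max_x\operatorname{avg}_y f^2(x,y)$ to $\max_{z_1,z_2}\max_x\operatorname{avg}_y(\text{if } z_1=z_2\text{ then } f^1(x,y)\text{ else } f^2(x,y))$. Let $T'[V]=SDP^1(SDP^2(V))$, $V_0=R$ and $V_{i+1}=T'[V_i]$; these are closed expressions that do not depend on $O$. **Theorem.** Under these assumptions, for every finite non-empty $O$, every interpretation of the constants in $O$ and every $i\ge 0$, as functions of the state, $$V_i\le V_{i+1}=T'[V_i]\le T[V_i]\le V^*.$$ -/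

import Mathlib

namespace ServiceDomains

/-! ### Discounted Markov decision processes -/

/-- A Markov decision process: transition probabilities `Pr(s' | s, a)`, state reward, discount. -/
structure MDP (S A : Type) where
  trans : S → A → S → ℝ
  reward : S → ℝ
  discount : ℝ

namespace MDP

variable {S A : Type}

/-- `∑_{s'} Pr(s' | s, a) f(s')` (each `Pr(· | s, a)` used below has finite support). -/
noncomputable def expect (M : MDP S A) (s : S) (a : A) (f : S → ℝ) : ℝ :=
  ∑ᶠ s', M.trans s a s' * f s'

/-- The Bellman backup `T[V](s) = max_a { R(s) + γ ∑_{s'} Pr(s' | s, a) V(s') }`. -/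
noncomputable def bellman (M : MDP S A) (V : S → ℝ) (s : S) : ℝ :=
  ⨆ a : A, (M.reward s + M.discount * M.expect s a V)

/-- The expected reward collected at time `t` when following the policy `π` from `s`. -/
noncomputable def rewardAt (M : MDP S A) (π : S → A) : ℕ → S → ℝ
  | 0, s => M.reward s
  | t + 1, s => M.expect s (π s) (rewardAt M π t)

/-- The expected discounted total reward of the policy `π` from `s`. -/
noncomputable def policyValue (M : MDP S A) (π : S → A) (s : S) : ℝ :=
  ∑' t : ℕ, M.discount ^ t * M.rewardAt π t s

/-- The optimal value function `V*`: the best expected discounted total reward of a policy. -/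
noncomputable def optimalValue (M : MDP S A) (s : S) : ℝ :=
  ⨆ π : S → A, M.policyValue π s

end MDP

/-! ### Function-free first-order language and decision diagrams -/

/-- A function-free vocabulary: constants and predicates with arities.
The special unary predicate `sp` is always present and is not listed in `Rel`. -/
structure Signature where
  Const : Type
  Rel : Type
  arity : Rel → ℕ

inductive Term (σ : Signature) (V : Type) : Type
  | const (c : σ.Const)
  | var (v : V)

inductive Atom (σ : Signature) (V : Type) : Type
  | rel (p : σ.Rel) (args : Fin (σ.arity p) → Term σ V)
  | sp (t : Term σ V)
  | eq (t u : Term σ V)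

/-- Decision diagrams (unfolded to trees) with variables in `V` and leaf labels in `L`:
an open expression. In `node a hi lo` the branch `hi` is taken when the atom `a` is true. -/
inductive Diagram (σ : Signature) (V L : Type) : Type
  | leaf (r : L)
  | node (a : Atom σ V) (hi lo : Diagram σ V L)

/-- The truth values of all predicates over the tuples of objects in `O`. The set of objects and
the meaning of the constants never change, and are kept outside of the state. -/
structure State (σ : Signature) (O : Type) where
  rel : (p : σ.Rel) → (Fin (σ.arity p) → O) → Bool
  sp : O → Bool

variable {σ : Signature} {V W L P O : Type}

def Term.subst (τ : V → Term σ W) : Term σ V → Term σ W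
  | .const c => .const c
  | .var v => τ v

def Atom.subst (τ : V → Term σ W) : Atom σ V → Atom σ W
  | .rel p args => .rel p (fun i => (args i).subst τ)
  | .sp t => .sp (t.subst τ)
  | .eq t u => .eq (t.subst τ) (u.subst τ)

def Term.eval (cst : σ.Const → O) (ζ : V → O) : Term σ V → O
  | .const c => cst c
  | .var v => ζ v

def Atom.eval [DecidableEq O] (cst : σ.Const → O) (s : State σ O) (ζ : V → O) : Atom σ V → Bool
  | .rel p args => s.rel p (fun i => (args i).eval cst ζ)
  | .sp t => s.sp (t.eval cst ζ)
  | .eq t u => decide (t.eval cst ζ = u.eval cst ζ)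

namespace Diagram

def subst (τ : V → Term σ W) : Diagram σ V L → Diagram σ W L
  | leaf r => leaf r
  | node a hi lo => node (a.subst τ) (hi.subst τ) (lo.subst τ)

def rename (f : V → W) (d : Diagram σ V L) : Diagram σ W L :=
  d.subst (fun v => .var (f v))

/-- The label of the leaf that is reached in the state `s` under the valuation `ζ`. -/
def eval [DecidableEq O] (cst : σ.Const → O) (s : State σ O) (ζ : V → O) : Diagram σ V L → L
  | leaf r => r
  | node a hi lo => bif a.eval cst s ζ then hi.eval cst s ζ else lo.eval cst s ζ

def map (f : L → L) : Diagram σ V L → Diagram σ V L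
  | leaf r => leaf (f r)
  | node a hi lo => node a (hi.map f) (lo.map f)

/-- A binary operation on open expressions. -/
def apply (op : L → L → L) : Diagram σ V L → Diagram σ V L → Diagram σ V L
  | leaf r, e => e.map (op r)
  | node a hi lo, e => node a (hi.apply op e) (lo.apply op e)

/-- Block replacement: `hi` is attached to the true leaves of a truth value diagram and `lo` to
its false leaves. -/
def graft (hi lo : Diagram σ V L) : Diagram σ V Bool → Diagram σ V L
  | leaf b => bif b then hi else lo
  | node a d e => node a (graft hi lo d) (graft hi lo e)

/-- The predicate `sp` occurs in the diagram only as `sp(t)` with `t ∈ A`. -/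
def SpOnly (A : Set (Term σ V)) : Diagram σ V L → Prop
  | leaf _ => True
  | node a hi lo => (∀ t, a = .sp t → t ∈ A) ∧ hi.SpOnly A ∧ lo.SpOnly A

end Diagram

/-! ### Actions -/

/-- A deterministic action variant with parameters `P`: the open expression `Pr(A_j(x) | A(x))`
over the parameters `x`, and for every predicate template `p(y)` the truth value diagram
`T(A_j(x), p(y))` over `x` and `y`, giving the truth value of `p(y)` in the next state. -/
structure Variant (σ : Signature) (P : Type) where
  prob : Diagram σ P ℝ
  tvd : (p : σ.Rel) → Diagram σ (P ⊕ Fin (σ.arity p)) Bool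
  tvdSp : Diagram σ (P ⊕ Unit) Bool

namespace Variant

/-- The state after the variant with parameters `o` has been executed in `s`. -/
def next [DecidableEq O] (v : Variant σ P) (cst : σ.Const → O) (o : P → O) (s : State σ O) :
    State σ O where
  rel p args := (v.tvd p).eval cst s (Sum.elim o args)
  sp b := v.tvdSp.eval cst s (Sum.elim o (fun _ => b))

/-- Regression of an open expression over the variant with parameters instantiated by `ρ`: every
atom is replaced by its truth value diagram; equalities do not change. -/
def regress (v : Variant σ P) (ρ : P → Term σ W) : Diagram σ W L → Diagram σ W L
  | .leaf r => .leaf r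
  | .node (.rel p args) hi lo =>
      .graft (regress v ρ hi) (regress v ρ lo) ((v.tvd p).subst (Sum.elim ρ args))
  | .node (.sp t) hi lo =>
      .graft (regress v ρ hi) (regress v ρ lo) (v.tvdSp.subst (Sum.elim ρ (fun _ => t)))
  | .node (.eq t u) hi lo => .node (.eq t u) (regress v ρ hi) (regress v ρ lo)

end Variant

/-- An agent action template `A(x_1, …, x_arity)` with its variants. -/
structure Action (σ : Signature) where
  arity : ℕ
  variants : List (Variant σ (Fin arity))

/-- The state-dependent choice probabilities form a distribution over the variants, in every
finite interpretation and for all parameters. -/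
def IsChoice (l : List (Variant σ P)) : Prop :=
  ∀ (O : Type) [Fintype O] [DecidableEq O] [Nonempty O] (cst : σ.Const → O) (s : State σ O)
    (o : P → O), (∀ v ∈ l, 0 ≤ v.prob.eval cst s o) ∧
      (l.map (fun v => v.prob.eval cst s o)).sum = 1

/-! ### Expressions `max_x avg_y f(x, y)` -/

/-- Variables of an expression: parameters (constants that are temporarily added to the
language), the maximization variables `x_1, …, x_k` and the averaging variable `y`. -/
inductive Var (P : Type) (k : ℕ) : Type
  | param (p : P)
  | x (i : Fin k)
  | y

def Var.val {k : ℕ} (o : P → O) (x : Fin k → O) (y : O) : Var P k → O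
  | .param p => o p
  | .x i => x i
  | .y => y

def Var.map {P Q : Type} {k l : ℕ} (f : P → Q) (g : Fin k → Fin l) : Var P k → Var Q l
  | .param p => .param (f p)
  | .x i => .x (g i)
  | .y => .y

/-- The expression `max_{x_1, …, x_k} avg_y body(x, y)`. It is closed when `P = Empty`. -/
structure Expr (σ : Signature) (P : Type) where
  k : ℕ
  body : Diagram σ (Var P k) ℝ

namespace Expr

noncomputable def eval [Fintype O] [DecidableEq O] (e : Expr σ P) (cst : σ.Const → O) (o : P → O)
    (s : State σ O) : ℝ :=
  ⨆ x : Fin e.k → O, (∑ y : O, e.body.eval cst s (Var.val o x y)) / (Fintype.card O : ℝ)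

/-- A closed expression as a function on states. -/
noncomputable def value [Fintype O] [DecidableEq O] (e : Expr σ Empty) (cst : σ.Const → O)
    (s : State σ O) : ℝ :=
  e.eval cst Empty.elim s

/-- A closed expression, in the language with the additional constants `P`. -/
def weaken (P : Type) (e : Expr σ Empty) : Expr σ P :=
  ⟨e.k, e.body.rename (Var.map Empty.elim id)⟩

/-- The operation `⊕`: the variables `x` are standardized apart, the variable `y` is shared. -/
noncomputable def add (e f : Expr σ P) : Expr σ P :=
  ⟨e.k + f.k, .apply (· + ·) (e.body.rename (Var.map id (Fin.castAdd f.k)))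
    (f.body.rename (Var.map id (Fin.natAdd e.k)))⟩

/-- The sum of a list of expressions, all standardized apart. -/
noncomputable def sum : List (Expr σ P) → Expr σ P
  | [] => ⟨0, .leaf 0⟩
  | e :: l => e.add (sum l)

/-- Multiplication of the open formula by an open expression over the parameters. -/
noncomputable def mulProb (q : Diagram σ P ℝ) (e : Expr σ P) : Expr σ P :=
  ⟨e.k, .apply (· * ·) (q.rename .param) e.body⟩

noncomputable def smul (c : ℝ) (e : Expr σ P) : Expr σ P :=
  ⟨e.k, e.body.map (c * ·)⟩

/-- Object maximization: the parameters are turned into maximization variables. -/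
def objectMax {m : ℕ} (e : Expr σ (Fin m)) : Expr σ Empty :=
  ⟨m + e.k, e.body.rename fun
    | .param p => .x (Fin.castAdd e.k p)
    | .x i => .x (Fin.natAdd m i)
    | .y => .y⟩

/-- The binary operation `max`:
`max_{z₁, z₂} max_x avg_y (if z₁ = z₂ then e(x, y) else f(x, y))`, where the variables `x`, `y`
are shared. -/
def maxOp (e f : Expr σ P) : Expr σ P :=
  ⟨2 + max e.k f.k,
    .node (.eq (.var (.x (Fin.castAdd _ 0))) (.var (.x (Fin.castAdd _ 1))))
      (e.body.rename (Var.map id fun i => Fin.natAdd 2 (Fin.castLE (le_max_left _ _) i)))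
      (f.body.rename (Var.map id fun i => Fin.natAdd 2 (Fin.castLE (le_max_right _ _) i)))⟩

/-- The maximum of a nonempty list of expressions (the value at `[]` is irrelevant). -/
noncomputable def maxList : List (Expr σ P) → Expr σ P
  | [] => ⟨0, .leaf 0⟩
  | [e] => e
  | e :: f :: l => e.maxOp (maxList (f :: l))

end Expr

/-! ### Service domains -/

/-- The description of a relational MDP with exogenous events: agent action templates, the
variants `E_j(i)` of the exogenous action centred at an object `i`, reward and discount factor. -/
structure Domain (σ : Signature) where
  actions : List (Action σ)
  event : List (Variant σ Unit)
  reward : Expr σ Empty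
  discount : ℝ

namespace Domain

/-! #### The template method -/

/-- `Q^{A(x)} = R ⊕ [γ ⊗ ⊕_j (Pr(A_j(x)) ⊗ Regr(V, A_j(x)))]`. -/
noncomputable def qExpr (D : Domain σ) (a : Action σ) (e : Expr σ Empty) :
    Expr σ (Fin a.arity) :=
  (D.reward.weaken _).add (.smul D.discount (.sum (a.variants.map fun v =>
    .mulProb v.prob ⟨e.k, v.regress (fun p => .var (.param p)) (e.weaken _).body⟩)))

/-- `SDP¹`: regression, adding of variants, object maximization, maximization over actions. -/
noncomputable def sdp1 (D : Domain σ) (e : Expr σ Empty) : Expr σ Empty :=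
  .maxList (D.actions.map fun a => (D.qExpr a e).objectMax)

/-- Variables of a partially grounded expression `max_x f(x, a)` with Skolem constant `a`. -/
inductive GVar (k : ℕ) : Type
  | a
  | x (i : Fin k)

/-- Grounding: the averaging variable `y` is replaced by the Skolem constant `a`. -/
def ground (e : Expr σ Empty) : Diagram σ (GVar e.k) ℝ :=
  e.body.rename fun
    | .param p => p.elim
    | .x i => .x i
    | .y => .a

/-- Lifting: `max_x W(x, a)` becomes `max_x avg_y W(x, y)`. -/
def lift {k : ℕ} (d : Diagram σ (GVar k) ℝ) : Expr σ Empty :=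
  ⟨k, d.rename fun
    | .a => .y
    | .x i => .x i⟩

/-- `⊕_j (Pr(E_j(a)) ⊗ Regr(V, E_j(a)))`, added without standardizing apart. -/
noncomputable def addVariants {k : ℕ} (d : Diagram σ (GVar k) ℝ) :
    List (Variant σ Unit) → Diagram σ (GVar k) ℝ
  | [] => .leaf 0
  | v :: l => .apply (· + ·)
      (.apply (· * ·) (v.prob.rename fun _ => .a) (v.regress (fun _ => .var .a) d))
      (addVariants d l)

/-- `SDP²`: grounding, regression over a generic exogenous action, adding of its variants,
lifting. -/
noncomputable def sdp2 (D : Domain σ) (e : Expr σ Empty) : Expr σ Empty :=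
  lift (addVariants (ground e) D.event)

/-- The approximate Bellman backup `T'[V] = SDP¹(SDP²(V))` of the template method. -/
noncomputable def approxBackup (D : Domain σ) (e : Expr σ Empty) : Expr σ Empty :=
  D.sdp1 (D.sdp2 e)

/-- The iterates `V_0 = R`, `V_{i+1} = T'[V_i]`. -/
noncomputable def iter (D : Domain σ) : ℕ → Expr σ Empty
  | 0 => D.reward
  | i + 1 => D.approxBackup (D.iter i)

/-! #### The true MDP over a finite set of objects -/

/-- Ground agent actions `A(o)`. -/
abbrev GroundAction (D : Domain σ) (O : Type) : Type :=
  (a : Fin D.actions.length) × (Fin (D.actions.get a).arity → O)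

section Ground

variable [Fintype O] [DecidableEq O] (D : Domain σ) (cst : σ.Const → O)

/-- The state after variant `j` of the exogenous action centred at `i`. -/
def eventNext (i : O) (j : Fin D.event.length) (s : State σ O) : State σ O :=
  (D.event.get j).next cst (fun _ => i) s

/-- The probability of variant `j` of the exogenous action centred at `i`, in the state `s`. -/
def eventProb (i : O) (j : Fin D.event.length) (s : State σ O) : ℝ :=
  (D.event.get j).prob.eval cst s (fun _ => i)

/-- Simultaneous application in `s` of the variants `j i` of all exogenous actions: the truth
values that change are those that are changed by at least one of them. -/
def simultaneous (j : O → Fin D.event.length) (s : State σ O) : State σ O where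
  rel p args := xor (s.rel p args)
    (decide (∃ i, (D.eventNext cst i (j i) s).rel p args ≠ s.rel p args))
  sp b := xor (s.sp b) (decide (∃ i, (D.eventNext cst i (j i) s).sp b ≠ s.sp b))

open Classical in
/-- The probability that all the exogenous actions together, with variants chosen independently
for the different objects, lead from `s` to `s'`. -/
noncomputable def exoProb (s s' : State σ O) : ℝ :=
  ∑ j : O → Fin D.event.length,
    if D.simultaneous cst j s = s' then ∏ i, D.eventProb cst i (j i) s else 0

open Classical in
/-- The probability that the exogenous actions, applied one after the other in the order given by
a list of objects, lead from `s` to `s'`. -/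
noncomputable def seqProb : List O → State σ O → State σ O → ℝ
  | [], s, s' => if s = s' then 1 else 0
  | i :: l, s, s' =>
      ∑ j : Fin D.event.length, D.eventProb cst i j s * seqProb l (D.eventNext cst i j s) s'

/-- The MDP over the objects `O`: in each step the agent's action is taken, with a random variant,
and then the exogenous actions of all objects. -/
noncomputable def mdp : MDP (State σ O) (D.GroundAction O) where
  trans s a s' :=
    ((D.actions.get a.1).variants.map fun v =>
      v.prob.eval cst s a.2 * D.exoProb cst (v.next cst a.2 s) s').sum
  reward := D.reward.value cst
  discount := D.discount

end Ground

/-! #### Assumptions -/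

/-- The description is that of a relational MDP: there is an agent action, the choice
probabilities are probabilities, and the discount factor is in `[0, 1)`. -/
structure WellFormed (D : Domain σ) : Prop where
  actions_ne : D.actions ≠ []
  action_choice : ∀ a ∈ D.actions, IsChoice a.variants
  event_choice : IsChoice D.event
  discount_nonneg : 0 ≤ D.discount
  discount_lt_one : D.discount < 1

/-- A1: the exogenous actions are centred at objects and do not interfere with each other: the
only atom subject to exogenous change that conditions of `E(i)` may mention is `sp(i)`. (The truth
value diagram for `sp(y)` may also mention `sp(y)`, as is needed when nothing changes.) -/
def NonInterfering (D : Domain σ) : Prop :=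
  ∀ v ∈ D.event, v.prob.SpOnly {.var ()} ∧
    (∀ p, (v.tvd p).SpOnly {.var (.inl ())}) ∧
    v.tvdSp.SpOnly {.var (.inl ()), .var (.inr ())}

/-- A2: the exogenous action centred at `i` can only change the truth value of `sp(i)`. -/
def EventsChangeOnlySp (D : Domain σ) : Prop :=
  ∀ (O : Type) [Fintype O] [DecidableEq O] [Nonempty O] (cst : σ.Const → O), ∀ v ∈ D.event,
    ∀ (i : O) (s : State σ O), (v.next cst (fun _ => i) s).rel = s.rel ∧
      ∀ b, b ≠ i → (v.next cst (fun _ => i) s).sp b = s.sp b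

/-- A3: `sp` does not occur in the conditions of agent actions: neither in choice probabilities
nor in truth value diagrams, except that the diagram for `sp(y)` may refer to the current truth
value of this same `sp(y)`. -/
def AgentConditionsSpFree (D : Domain σ) : Prop :=
  ∀ a ∈ D.actions, ∀ v ∈ a.variants, v.prob.SpOnly ∅ ∧ (∀ p, (v.tvd p).SpOnly ∅) ∧
    v.tvdSp.SpOnly {.var (.inr ())}

/-- A4: the reward `max_x avg_y R(x, y)` mentions `sp` only as `sp(y)`. -/
def RewardSpOnlyAvg (D : Domain σ) : Prop :=
  D.reward.body.SpOnly {.var .y}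

/-- The open expression `R(x, y)` of the reward has no negative values. -/
def RewardNonneg (D : Domain σ) : Prop :=
  ∀ (O : Type) [Fintype O] [DecidableEq O] [Nonempty O] (cst : σ.Const → O) (s : State σ O)
    (x : Fin D.reward.k → O) (y : O), 0 ≤ D.reward.body.eval cst s (Var.val Empty.elim x y)

/-! #### The non-interference condition makes simultaneous and sequential application agree -/

theorem Diagram_eval_congr [DecidableEq O] (cst : σ.Const → O) (s s' : State σ O) (ζ : V → O)
    (A : Set (Term σ V)) (hrel : s.rel = s'.rel)
    (hsp : ∀ t ∈ A, s.sp (t.eval cst ζ) = s'.sp (t.eval cst ζ)) (d : Diagram σ V L)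
    (hd : d.SpOnly A) : d.eval cst s ζ = d.eval cst s' ζ := by
  induction d with
  | leaf r => rfl
  | node a hi lo ih1 ih2 =>
    obtain ⟨h, h1, h2⟩ := hd
    have ha : a.eval cst s ζ = a.eval cst s' ζ := by
      cases a with
      | rel p args => simp [Atom.eval, hrel]
      | sp t => simpa [Atom.eval] using hsp t (h t rfl)
      | eq t u => rfl
    simp only [Diagram.eval, ha, ih1 h1, ih2 h2]

theorem sum_update_aux {n : ℕ} [Fintype O] [DecidableEq O] (i : O) (a : Fin n → ℝ)
    (c : Fin n → Fin n → ℝ) (hc : ∀ x, ∑ y, c x y = 1) (G : (O → Fin n) → ℝ) :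
    ∑ x, a x * ∑ j : O → Fin n, c x (j i) * G (Function.update j i x) =
      ∑ j : O → Fin n, a (j i) * G j := by
  have key : ∀ H : (O → Fin n) → ℝ, ∑ j, H j =
      ∑ x, ∑ g : {k // k ≠ i} → Fin n, H ((Equiv.funSplitAt i (Fin n)).symm (x, g)) := by
    intro H
    rw [← Fintype.sum_prod_type', ← (Equiv.funSplitAt i (Fin n)).symm.sum_comp]
  have hi : ∀ x g, (Equiv.funSplitAt i (Fin n)).symm (x, g) i = x := by
    intro x g; simp [Equiv.funSplitAt, Equiv.piSplitAt]
  have hu : ∀ x y g, Function.update ((Equiv.funSplitAt i (Fin n)).symm (y, g)) i x =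
      (Equiv.funSplitAt i (Fin n)).symm (x, g) := by
    intro x y g
    funext k
    by_cases hk : k = i
    · subst hk; simp [Equiv.funSplitAt, Equiv.piSplitAt]
    · simp [Equiv.funSplitAt, Equiv.piSplitAt, hk]
  rw [key]
  refine Finset.sum_congr rfl fun x _ => ?_
  rw [key]
  simp only [hi, hu, ← Finset.mul_sum]
  rw [← Finset.sum_mul, hc, one_mul]

/-- Under A1 and A2, the simultaneous application of all exogenous actions is equivalent to their
sequential application, in any order. -/
theorem seqProb_eq_exoProb [Fintype O] [DecidableEq O] [Nonempty O] (D : Domain σ)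
    (hc : IsChoice D.event) (A1 : D.NonInterfering) (A2 : D.EventsChangeOnlySp)
    (cst : σ.Const → O) (l : List O) (hl : l.Nodup) (hmem : ∀ i, i ∈ l) (s s' : State σ O) :
    D.seqProb cst l s s' = D.exoProb cst s s' := by
  classical
  have hsum : ∀ (i : O) (s : State σ O), ∑ j, D.eventProb cst i j s = 1 := by
    intro i s
    rw [← (hc O cst s (fun _ => i)).2, ← List.sum_ofFn]
    congr 1
    apply List.ext_get <;> simp [eventProb]
  have hrel : ∀ i j (s : State σ O), (D.eventNext cst i j s).rel = s.rel := fun i j s =>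
    (A2 O cst _ (List.get_mem _ j) i s).1
  have hsp : ∀ i j (s : State σ O) b, b ≠ i → (D.eventNext cst i j s).sp b = s.sp b :=
    fun i j s => (A2 O cst _ (List.get_mem _ j) i s).2
  have hprob : ∀ i j (s s1 : State σ O), s.rel = s1.rel → s.sp i = s1.sp i →
      D.eventProb cst i j s = D.eventProb cst i j s1 := by
    intro i j s s1 h1 h2
    refine Diagram_eval_congr cst s s1 _ _ h1 ?_ _ (A1 _ (List.get_mem _ j)).1
    rintro t rfl
    exact h2
  have hnext : ∀ i j (s s1 : State σ O), s.rel = s1.rel → s.sp i = s1.sp i →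
      (D.eventNext cst i j s).sp i = (D.eventNext cst i j s1).sp i := by
    intro i j s s1 h1 h2
    refine Diagram_eval_congr cst s s1 _ _ h1 ?_ _ (A1 _ (List.get_mem _ j)).2.2
    rintro t (rfl | rfl) <;> exact h2
  let upd : List O → (O → Fin D.event.length) → State σ O → State σ O := fun l j s =>
    ⟨s.rel, fun b => if b ∈ l then (D.eventNext cst b (j b) s).sp b else s.sp b⟩
  have main : ∀ (l : List O), l.Nodup → ∀ s, D.seqProb cst l s s' =
      ∑ j : O → Fin D.event.length,
        (∏ i, D.eventProb cst i (j i) s) * if upd l j s = s' then 1 else 0 := by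
    intro l
    induction l with
    | nil =>
      intro _ s
      have : ∀ j, upd [] j s = s := by intro j; simp [upd]
      simp only [this, ← Finset.sum_mul, seqProb]
      rw [← Fintype.prod_sum (fun i x => D.eventProb cst i x s)]
      simp [hsum]
    | cons i l ih =>
      intro hn s
      obtain ⟨hil, hn⟩ := List.nodup_cons.1 hn
      simp only [seqProb, ih hn]
      have h1 : ∀ j0 j, upd l j (D.eventNext cst i j0 s) =
          upd (i :: l) (Function.update j i j0) s := by
        intro j0 j
        simp only [upd, State.mk.injEq, hrel, true_and]
        funext b
        by_cases hb : b = i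
        · subst hb; simp [hil]
        · by_cases hbl : b ∈ l
          · simp only [hbl, List.mem_cons, or_true, if_true, Function.update_of_ne hb]
            exact hnext _ _ _ _ (hrel _ _ _) (hsp _ _ _ _ hb)
          · simp [hbl, hb, hsp]
      have h2 : ∀ j0 (j : O → Fin D.event.length),
          ∏ k, D.eventProb cst k (j k) (D.eventNext cst i j0 s) =
          D.eventProb cst i (j i) (D.eventNext cst i j0 s) *
            ∏ k ∈ Finset.univ.erase i, D.eventProb cst k (Function.update j i j0 k) s := by
        intro j0 j
        rw [← Finset.mul_prod_erase _ _ (Finset.mem_univ i)]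
        congr 1
        refine Finset.prod_congr rfl fun k hk => ?_
        have hk := Finset.ne_of_mem_erase hk
        rw [Function.update_of_ne hk]
        exact hprob _ _ _ _ (hrel _ _ _) (hsp _ _ _ _ hk)
      simp only [h1, h2, mul_assoc]
      rw [sum_update_aux i (fun x => D.eventProb cst i x s)
        (fun x y => D.eventProb cst i y (D.eventNext cst i x s)) (fun x => hsum _ _)
        (fun j => (∏ k ∈ Finset.univ.erase i, D.eventProb cst k (j k) s) *
          if upd (i :: l) j s = s' then 1 else 0)]
      refine Finset.sum_congr rfl fun j _ => ?_
      rw [← mul_assoc, Finset.mul_prod_erase _ (fun k => D.eventProb cst k (j k) s)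
        (Finset.mem_univ i)]
  rw [main l hl s, exoProb]
  refine Finset.sum_congr rfl fun j _ => ?_
  have : upd l j s = D.simultaneous cst j s := by
    simp only [upd, simultaneous, State.mk.injEq, hrel]
    refine ⟨by simp, ?_⟩
    funext b
    have hex : (∃ i, (D.eventNext cst i (j i) s).sp b ≠ s.sp b) ↔
        (D.eventNext cst b (j b) s).sp b ≠ s.sp b := by
      refine ⟨?_, fun h => ⟨b, h⟩⟩
      rintro ⟨i, h⟩
      by_cases hb : b = i
      · subst hb; exact h
      · exact absurd (hsp _ _ _ _ hb) h
    simp only [hex, hmem, if_true]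
    cases (D.eventNext cst b (j b) s).sp b <;> cases s.sp b <;> simp
  rw [this]
  split_ifs <;> simp

end Domain

end ServiceDomains

/-! Two invariants of the open formula `V(x,y)` carry the argument. `Local`: its value depends on
`sp` only at `y`. `Dominated`: each `x` has an `x'` with `e(x,y) ≤ f(x',y)` for all `y`, and `x'`
does not depend on `sp`.

Every iterate is local (`local_iter`). For fixed `x` and `y`, the effect of all events together on
`V(x,y)` is then the effect of `E(y)` alone, so `W(x,y)` is exactly the expectation of `V(x,y)`
under the joint event. Averaging over `y` commutes with the expectation, and a maximum of
expectations is at most the expectation of the maximum; this gives `value_sdp2_le`. The agent's step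
loses nothing in this direction, hence `T'[V] ≤ T[V]` (`value_approxBackup_le_bellman`).

Comparing values state by state would not give monotonicity of `T'`: in `SDP²` one `x` must serve
all variants and all `y`, whose successor states differ in `sp`. Domination is strong enough, since
events leave the other predicates unchanged and agent actions change them independently of `sp`. `R`
is dominated by `T'[R]` because rewards are non-negative, and `T'` preserves domination, so `V_i ≤
V_{i+1}` (`iter_dominated_succ`).

Together these give `V_i ≤ T[V_i]`. The policy that is greedy for `V_i` then has value at least
`T[V_i]`, by iterating its backup (`bellman_le_optimalValue`). -/

namespace ServiceDomains

variable {σ : Signature} {V W L P O : Type}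

/-! ### Policy evaluation in Markov decision processes -/

namespace MDP

variable {S A : Type}

/-- Every `Pr(· | s, a)` is a finite convex combination of point masses. -/
def FinitelySupported (M : MDP S A) : Prop :=
  ∀ s a, ∃ (ι : Type) (_ : Fintype ι) (w : ι → ℝ) (g : ι → S), (∀ i, 0 ≤ w i) ∧ ∑ i, w i = 1 ∧
    ∀ f : S → ℝ, M.expect s a f = ∑ i, w i * f (g i)

/-- The transition probabilities vanish outside the finite image of `g`. As `g` need not be
injective, the mass of a state is collected over its whole fibre. -/
theorem expect_eq_sum {ι : Type} [Fintype ι] [DecidableEq S] (M : MDP S A) (s : S) (a : A)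
    (w : ι → ℝ) (g : ι → S) (h : ∀ s', M.trans s a s' = ∑ i, if g i = s' then w i else 0)
    (f : S → ℝ) : M.expect s a f = ∑ i, w i * f (g i) := by
  unfold expect
  rw [finsum_eq_sum_of_support_subset (s := Finset.univ.image g)]
  · simp only [h, Finset.sum_mul]
    rw [Finset.sum_comm]
    refine Finset.sum_congr rfl fun i _ => ?_
    rw [Finset.sum_eq_single (g i)]
    · simp
    · intro b _ hb
      simp [hb.symm]
    · intro hi
      simp at hi
  · intro s' hs'
    by_contra hn
    apply hs'
    have : M.trans s a s' = 0 := by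
      rw [h]
      refine Finset.sum_eq_zero fun i _ => if_neg fun hi => hn ?_
      simp [← hi]
    simp [this]

namespace FinitelySupported

variable {M : MDP S A} (hM : M.FinitelySupported)

include hM

theorem expect_mono {f g : S → ℝ} (h : f ≤ g) (s : S) (a : A) :
    M.expect s a f ≤ M.expect s a g := by
  obtain ⟨ι, _, w, e, hw, -, he⟩ := hM s a
  rw [he, he]
  exact Finset.sum_le_sum fun i _ => mul_le_mul_of_nonneg_left (h _) (hw i)

theorem expect_const (s : S) (a : A) (c : ℝ) : M.expect s a (fun _ => c) = c := by
  obtain ⟨ι, _, w, e, -, hw, he⟩ := hM s a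
  rw [he, ← Finset.sum_mul, hw, one_mul]

theorem expect_add (s : S) (a : A) (f g : S → ℝ) :
    M.expect s a (fun x => f x + g x) = M.expect s a f + M.expect s a g := by
  obtain ⟨ι, _, w, e, -, -, he⟩ := hM s a
  simp only [he, mul_add, Finset.sum_add_distrib]

theorem expect_sum_mul (s : S) (a : A) (n : ℕ) (c : ℕ → ℝ) (f : ℕ → S → ℝ) :
    M.expect s a (fun x => ∑ t ∈ Finset.range n, c t * f t x) =
      ∑ t ∈ Finset.range n, c t * M.expect s a (f t) := by
  obtain ⟨ι, _, w, e, -, -, he⟩ := hM s a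
  simp only [he, Finset.mul_sum]
  rw [Finset.sum_comm]
  refine Finset.sum_congr rfl fun t _ => Finset.sum_congr rfl fun i _ => by ring

theorem rewardAt_nonneg (hr : ∀ s, 0 ≤ M.reward s) (π : S → A) (t : ℕ) (s : S) :
    0 ≤ M.rewardAt π t s := by
  induction t generalizing s with
  | zero => exact hr s
  | succ t ih =>
    rw [rewardAt, ← hM.expect_const s (π s) 0]
    exact hM.expect_mono ih s (π s)

theorem rewardAt_le {B : ℝ} (hr : ∀ s, M.reward s ≤ B) (π : S → A) (t : ℕ) (s : S) :
    M.rewardAt π t s ≤ B := by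
  induction t generalizing s with
  | zero => exact hr s
  | succ t ih =>
    rw [rewardAt, ← hM.expect_const s (π s) B]
    exact hM.expect_mono ih s (π s)

variable (h0 : 0 ≤ M.discount) (h1 : M.discount < 1)

include h0 h1

theorem summable_rewardAt {B : ℝ} (hr0 : ∀ s, 0 ≤ M.reward s) (hr : ∀ s, M.reward s ≤ B)
    (π : S → A) (s : S) : Summable fun t => M.discount ^ t * M.rewardAt π t s :=
  Summable.of_nonneg_of_le
    (fun t => mul_nonneg (pow_nonneg h0 t) (hM.rewardAt_nonneg hr0 π t s))
    (fun t => mul_le_mul_of_nonneg_left (hM.rewardAt_le hr π t s) (pow_nonneg h0 t))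
    ((summable_geometric_of_lt_one h0 h1).mul_right B)

/-- An unbounded real supremum would take the default value `0`; this bound lets each policy value
be compared with `optimalValue`. -/
theorem bddAbove_policyValue {B : ℝ} (hr0 : ∀ s, 0 ≤ M.reward s) (hr : ∀ s, M.reward s ≤ B)
    (s : S) : BddAbove (Set.range fun π : S → A => M.policyValue π s) := by
  refine ⟨∑' t : ℕ, M.discount ^ t * B, ?_⟩
  rintro _ ⟨π, rfl⟩
  exact (hM.summable_rewardAt h0 h1 hr0 hr π s).tsum_le_tsum
    (fun t => mul_le_mul_of_nonneg_left (hM.rewardAt_le hr π t s) (pow_nonneg h0 t))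
    ((summable_geometric_of_lt_one h0 h1).mul_right B)

/-- A bounded function that the one-step backup of a policy does not decrease is a lower bound,
together with its backup, for the value of the policy. -/
theorem backup_le_policyValue {B C : ℝ} (hr0 : ∀ s, 0 ≤ M.reward s) (hr : ∀ s, M.reward s ≤ B)
    {U : S → ℝ} (hU : ∀ s, U s ≤ C) (π : S → A)
    (hstep : ∀ s, U s ≤ M.reward s + M.discount * M.expect s (π s) U) (s : S) :
    M.reward s + M.discount * M.expect s (π s) U ≤ M.policyValue π s := by
  -- The value of following `π` for `n` steps and then receiving the terminal payoff `C`: the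
  -- `n`-fold backup of the constant `C`, which lies above `U`.
  let F : ℕ → S → ℝ := fun n s =>
    (∑ t ∈ Finset.range n, M.discount ^ t * M.rewardAt π t s) + M.discount ^ n * C
  have hF : ∀ n s, F (n + 1) s = M.reward s + M.discount * M.expect s (π s) (F n) := by
    intro n s
    simp only [F]
    rw [hM.expect_add, hM.expect_const, hM.expect_sum_mul, Finset.sum_range_succ', mul_add,
      Finset.mul_sum]
    simp only [rewardAt, pow_succ, pow_zero, one_mul]
    have : ∀ t, M.discount ^ t * M.discount * M.expect s (π s) (M.rewardAt π t) =
        M.discount * (M.discount ^ t * M.expect s (π s) (M.rewardAt π t)) := fun t => by ring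
    simp only [this]
    ring
  have hback : ∀ n, U ≤ F n → ∀ s,
      M.reward s + M.discount * M.expect s (π s) U ≤ F (n + 1) s := by
    intro n hn s
    rw [hF]
    have := mul_le_mul_of_nonneg_left (hM.expect_mono hn s (π s)) h0
    linarith
  have hUF : ∀ n, U ≤ F n := by
    intro n
    induction n with
    | zero => intro s; simpa [F] using hU s
    | succ n ih => exact fun s => (hstep s).trans (hback n ih s)
  have hlim : Filter.Tendsto (fun n => F n s) Filter.atTop (nhds (M.policyValue π s)) := by
    have ha := (hM.summable_rewardAt h0 h1 hr0 hr π s).hasSum.tendsto_sum_nat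
    have hb := (tendsto_pow_atTop_nhds_zero_of_lt_one h0 h1).mul_const C
    simpa [F, policyValue] using ha.add hb
  -- `hback` bounds `F (n + 1)`, so the limit is taken along the shifted sequence; the payoff `γ ^ n
  -- * C` dies out.
  exact ge_of_tendsto' (hlim.comp (Filter.tendsto_add_atTop_nat 1))
    fun n => hback n (hUF n) s

/-- A bounded function below its Bellman backup: the backup is below the optimal value. -/
theorem bellman_le_optimalValue [Finite A] [Nonempty A] {B C : ℝ} (hr0 : ∀ s, 0 ≤ M.reward s)
    (hr : ∀ s, M.reward s ≤ B) {U : S → ℝ} (hU : ∀ s, U s ≤ C) (hstep : U ≤ M.bellman U) :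
    M.bellman U ≤ M.optimalValue := by
  -- There are finitely many actions, so the maximum is attained and a greedy policy exists.
  have hex : ∀ s, ∃ a, M.reward s + M.discount * M.expect s a U = M.bellman U s :=
    fun s => exists_eq_ciSup_of_finite
  choose π hπ using hex
  intro s
  rw [← hπ s]
  exact (hM.backup_le_policyValue h0 h1 hr0 hr hU π
    (fun s => (hstep s).trans_eq (hπ s).symm) s).trans
    (le_ciSup (hM.bddAbove_policyValue h0 h1 hr0 hr s) π)

end FinitelySupported

end MDP

/-! ### Evaluation of the operations on decision diagrams -/

section Evaluation

theorem Term.eval_subst (cst : σ.Const → O) (τ : V → Term σ W) (ζ : W → O) (t : Term σ V) :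
    (t.subst τ).eval cst ζ = t.eval cst (fun v => (τ v).eval cst ζ) := by
  cases t <;> rfl

variable [DecidableEq O] (cst : σ.Const → O) (s : State σ O)

theorem Atom.eval_subst (τ : V → Term σ W) (ζ : W → O) (a : Atom σ V) :
    (a.subst τ).eval cst s ζ = a.eval cst s (fun v => (τ v).eval cst ζ) := by
  cases a <;> simp [Atom.subst, Atom.eval, Term.eval_subst]

namespace Diagram

theorem eval_subst (τ : V → Term σ W) (ζ : W → O) (d : Diagram σ V L) :
    (d.subst τ).eval cst s ζ = d.eval cst s (fun v => (τ v).eval cst ζ) := by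
  induction d with
  | leaf r => rfl
  | node a hi lo ih1 ih2 => simp only [subst, eval, Atom.eval_subst, ih1, ih2]

theorem eval_rename (f : V → W) (ζ : W → O) (d : Diagram σ V L) :
    (d.rename f).eval cst s ζ = d.eval cst s (fun v => ζ (f v)) :=
  eval_subst cst s _ ζ d

theorem eval_map (f : L → L) (ζ : V → O) (d : Diagram σ V L) :
    (d.map f).eval cst s ζ = f (d.eval cst s ζ) := by
  induction d with
  | leaf r => rfl
  | node a hi lo ih1 ih2 =>
    simp only [map, eval, ih1, ih2]
    cases a.eval cst s ζ <;> rfl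

theorem eval_apply (op : L → L → L) (ζ : V → O) (d e : Diagram σ V L) :
    (d.apply op e).eval cst s ζ = op (d.eval cst s ζ) (e.eval cst s ζ) := by
  induction d with
  | leaf r => exact eval_map cst s (op r) ζ e
  | node a hi lo ih1 ih2 =>
    simp only [apply, eval, ih1, ih2]
    cases a.eval cst s ζ <;> rfl

theorem eval_graft (ζ : V → O) (hi lo : Diagram σ V L) (d : Diagram σ V Bool) :
    (graft hi lo d).eval cst s ζ =
      bif d.eval cst s ζ then hi.eval cst s ζ else lo.eval cst s ζ := by
  induction d with
  | leaf b => cases b <;> rfl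
  | node a d e ih1 ih2 =>
    simp only [graft, eval, ih1, ih2]
    cases a.eval cst s ζ <;> rfl

/-- An open expression takes finitely many values. -/
theorem exists_eval_le (d : Diagram σ V ℝ) :
    ∃ B, ∀ (s : State σ O) (ζ : V → O), d.eval cst s ζ ≤ B := by
  induction d with
  | leaf r => exact ⟨r, fun _ _ => le_rfl⟩
  | node a hi lo ih1 ih2 =>
    obtain ⟨B, hB⟩ := ih1
    obtain ⟨C, hC⟩ := ih2
    refine ⟨max B C, fun s ζ => ?_⟩
    simp only [eval]
    cases a.eval cst s ζ
    · exact (hC s ζ).trans (le_max_right _ _)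
    · exact (hB s ζ).trans (le_max_left _ _)

end Diagram

/-- The truth value diagram of an atom, evaluated in `s`, is by definition the atom's truth value in
the next state, and `graft` branches on exactly that value. -/
theorem Variant.eval_regress (v : Variant σ P) (ρ : P → Term σ W) (ζ : W → O)
    (d : Diagram σ W L) : (v.regress ρ d).eval cst s ζ =
      d.eval cst (v.next cst (fun p => (ρ p).eval cst ζ) s) ζ := by
  induction d with
  | leaf r => rfl
  | node a hi lo ih1 ih2 =>
    cases a with
    | rel p args =>
      simp only [regress, Diagram.eval_graft, Diagram.eval_subst, Diagram.eval, ih1, ih2,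
        Atom.eval, next]
      congr 2
      funext x
      cases x <;> rfl
    | sp t =>
      simp only [regress, Diagram.eval_graft, Diagram.eval_subst, Diagram.eval, ih1, ih2,
        Atom.eval, next]
      congr 2
      funext x
      cases x <;> rfl
    | eq t u => simp only [regress, Diagram.eval, ih1, ih2, Atom.eval]

end Evaluation

/-! ### Expressions `max_x avg_y f(x, y)`: pointwise evaluation -/

namespace Expr

/-- In `maxOp` the operand with fewer variables reads only an initial segment of the shared ones;
the rest can be filled arbitrarily. -/
theorem exists_castLE_eq [Nonempty O] {m n : ℕ} (h : m ≤ n) (x : Fin m → O) :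
    ∃ z : Fin n → O, ∀ i, z (Fin.castLE h i) = x i := by
  obtain ⟨z, hz⟩ := (Fin.castLE_injective h).surjective_comp_right x
  exact ⟨z, congrFun hz⟩

section Pointwise

variable [DecidableEq O] (cst : σ.Const → O)

/-- The value of the open formula of an expression. -/
def bodyVal (e : Expr σ P) (s : State σ O) (o : P → O) (x : Fin e.k → O) (y : O) : ℝ :=
  e.body.eval cst s (Var.val o x y)

/-- Regression of a closed expression over a variant whose parameters are kept as constants. -/
def regress (e : Expr σ Empty) (v : Variant σ P) : Expr σ P :=
  ⟨e.k, v.regress (fun p => .var (.param p)) (e.weaken _).body⟩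

variable (s : State σ O)

theorem bodyVal_weaken (e : Expr σ Empty) (o : P → O) (x : Fin e.k → O) (y : O) :
    (e.weaken P).bodyVal cst s o x y = e.bodyVal cst s Empty.elim x y := by
  unfold bodyVal weaken
  rw [Diagram.eval_rename]
  congr 1
  funext v
  cases v with
  | param p => exact p.elim
  | x i => rfl
  | y => rfl

theorem bodyVal_regress (e : Expr σ Empty) (v : Variant σ P) (o : P → O) (x : Fin e.k → O)
    (y : O) : (e.regress v).bodyVal cst s o x y =
      e.bodyVal cst (v.next cst o s) Empty.elim x y := by
  rw [← bodyVal_weaken]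
  exact Variant.eval_regress cst s v _ _ _

theorem bodyVal_add (e f : Expr σ P) (o : P → O) (x : Fin (e.add f).k → O) (y : O) :
    (e.add f).bodyVal cst s o x y =
      e.bodyVal cst s o (fun i => x (Fin.castAdd f.k i)) y +
        f.bodyVal cst s o (fun i => x (Fin.natAdd e.k i)) y := by
  unfold bodyVal add
  rw [Diagram.eval_apply, Diagram.eval_rename, Diagram.eval_rename]
  congr 2 <;> funext v <;> cases v <;> rfl

theorem bodyVal_mulProb (q : Diagram σ P ℝ) (e : Expr σ P) (o : P → O)
    (x : Fin (mulProb q e).k → O) (y : O) :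
    (mulProb q e).bodyVal cst s o x y = q.eval cst s o * e.bodyVal cst s o x y := by
  unfold bodyVal mulProb
  rw [Diagram.eval_apply, Diagram.eval_rename]
  rfl

theorem bodyVal_smul (c : ℝ) (e : Expr σ P) (o : P → O) (x : Fin (smul c e).k → O) (y : O) :
    (smul c e).bodyVal cst s o x y = c * e.bodyVal cst s o x y :=
  Diagram.eval_map cst s _ _ _

theorem bodyVal_objectMax {m : ℕ} (e : Expr σ (Fin m)) (o : Empty → O)
    (x : Fin e.objectMax.k → O) (y : O) : e.objectMax.bodyVal cst s o x y =
      e.bodyVal cst s (fun i => x (Fin.castAdd e.k i)) (fun i => x (Fin.natAdd m i)) y := by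
  unfold bodyVal objectMax
  rw [Diagram.eval_rename]
  congr 1
  funext v
  cases v <;> rfl

theorem bodyVal_maxOp (e f : Expr σ P) (o : P → O) (x : Fin (e.maxOp f).k → O) (y : O) :
    (e.maxOp f).bodyVal cst s o x y =
      if x (Fin.castAdd (max e.k f.k) 0) = x (Fin.castAdd (max e.k f.k) 1) then
        e.bodyVal cst s o (fun i => x (Fin.natAdd 2 (Fin.castLE (le_max_left _ _) i))) y
      else f.bodyVal cst s o (fun i => x (Fin.natAdd 2 (Fin.castLE (le_max_right _ _) i))) y := by
  unfold bodyVal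
  have hmap : ∀ {k : ℕ} (g : Fin k → Fin (e.maxOp f).k) (d : Diagram σ (Var P k) ℝ),
      (d.rename (Var.map id g)).eval cst s (Var.val o x y) =
        d.eval cst s (Var.val o (fun i => x (g i)) y) := by
    intro k g d
    rw [Diagram.eval_rename]
    congr 1
    funext v
    cases v <;> rfl
  exact (Bool.cond_decide (x (Fin.castAdd (max e.k f.k) 0) = x (Fin.castAdd (max e.k f.k) 1))
    _ _).trans (congrArg₂ (ite _) (hmap _ _) (hmap _ _))

/-- The two blocks of variables are disjoint, so witnesses chosen separately for the operands can be
joined. -/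
theorem bodyVal_add_append (e f : Expr σ P) (o : P → O) (x : Fin e.k → O) (x' : Fin f.k → O)
    (y : O) : (e.add f).bodyVal cst s o (Fin.append x x') y =
      e.bodyVal cst s o x y + f.bodyVal cst s o x' y :=
  (bodyVal_add cst s e f o (Fin.append x x') y).trans
    (by simp only [Fin.append_left, Fin.append_right])

theorem bodyVal_objectMax_append {m : ℕ} (e : Expr σ (Fin m)) (o : Empty → O) (u : Fin m → O)
    (x : Fin e.k → O) (y : O) :
    e.objectMax.bodyVal cst s o (Fin.append u x) y = e.bodyVal cst s u x y :=
  (bodyVal_objectMax cst s e o (Fin.append u x) y).trans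
    (by simp only [Fin.append_left, Fin.append_right])

theorem bodyVal_maxOp_append (e f : Expr σ P) (o : P → O) (c : Fin 2 → O)
    (z : Fin (max e.k f.k) → O) (y : O) :
    (e.maxOp f).bodyVal cst s o (Fin.append c z) y =
      if c 0 = c 1 then e.bodyVal cst s o (fun i => z (Fin.castLE (le_max_left _ _) i)) y
      else f.bodyVal cst s o (fun i => z (Fin.castLE (le_max_right _ _) i)) y :=
  (bodyVal_maxOp cst s e f o (Fin.append c z) y).trans
    (by simp only [Fin.append_left, Fin.append_right])

/-! #### Non-negative, local and dominated expressions -/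

/-- The open formula has no negative values. -/
def Nonneg (e : Expr σ P) : Prop :=
  ∀ (s : State σ O) o x y, 0 ≤ e.bodyVal cst s o x y

/-- The value of the open formula depends on the truth value of `sp` only at `y`. -/
def Local (e : Expr σ P) : Prop :=
  ∀ (s s' : State σ O) o x y, s.rel = s'.rel → s.sp y = s'.sp y →
    e.bodyVal cst s o x y = e.bodyVal cst s' o x y

/-- For each `x` there is an `x'`, not depending on the truth values of `sp`, such that
`e(x, y) ≤ f(x', y)` for all `y`. -/
def Dominated (e f : Expr σ P) : Prop :=
  ∀ (r : (p : σ.Rel) → (Fin (σ.arity p) → O) → Bool) (o : P → O) (x : Fin e.k → O),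
    ∃ x' : Fin f.k → O, ∀ s : State σ O, s.rel = r → ∀ y,
      e.bodyVal cst s o x y ≤ f.bodyVal cst s o x' y

variable {cst}

/-! ### Closure of non-negativity and locality under the operations. -/

theorem Nonneg.regress {e : Expr σ Empty} (h : e.Nonneg cst) (v : Variant σ P) :
    (e.regress v).Nonneg cst := by
  intro s o x y
  exact (h _ _ _ _).trans_eq (bodyVal_regress cst s e v o x y).symm

theorem Nonneg.add {e f : Expr σ P} (he : e.Nonneg cst) (hf : f.Nonneg cst) :
    (e.add f).Nonneg cst := by
  intro s o x y
  rw [bodyVal_add]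
  exact add_nonneg (he _ _ _ _) (hf _ _ _ _)

theorem Nonneg.sum {l : List (Expr σ P)} (h : ∀ e ∈ l, e.Nonneg cst) : (sum l).Nonneg cst := by
  induction l with
  | nil => exact fun s o x y => le_rfl
  | cons e l ih =>
    exact Nonneg.add (h e (by simp)) (ih fun f hf => h f (by simp [hf]))

theorem Nonneg.mulProb {q : Diagram σ P ℝ} {e : Expr σ P}
    (hq : ∀ (s : State σ O) o, 0 ≤ q.eval cst s o) (he : e.Nonneg cst) :
    (mulProb q e).Nonneg cst := by
  intro s o x y
  rw [bodyVal_mulProb]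
  exact mul_nonneg (hq _ _) (he _ _ _ _)

theorem Nonneg.smul {c : ℝ} (hc : 0 ≤ c) {e : Expr σ P} (he : e.Nonneg cst) :
    (smul c e).Nonneg cst := by
  intro s o x y
  rw [bodyVal_smul]
  exact mul_nonneg hc (he _ _ _ _)

theorem Local.weaken {e : Expr σ Empty} (h : e.Local cst) : (e.weaken P).Local cst := by
  intro s s' o x y hr hs
  exact (bodyVal_weaken cst s e o x y).trans
    ((h _ _ _ _ _ hr hs).trans (bodyVal_weaken cst s' e o x y).symm)

theorem Local.regress {e : Expr σ Empty} (h : e.Local cst) {v : Variant σ P}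
    (hrel : ∀ (s s' : State σ O) o, s.rel = s'.rel → (v.next cst o s).rel = (v.next cst o s').rel)
    (hsp : ∀ (s s' : State σ O) o y, s.rel = s'.rel → s.sp y = s'.sp y →
      (v.next cst o s).sp y = (v.next cst o s').sp y) :
    (e.regress v).Local cst := by
  intro s s' o x y hr hs
  exact (bodyVal_regress cst s e v o x y).trans
    ((h _ _ _ _ _ (hrel _ _ _ hr) (hsp _ _ _ _ hr hs)).trans
      (bodyVal_regress cst s' e v o x y).symm)

theorem Local.add {e f : Expr σ P} (he : e.Local cst) (hf : f.Local cst) :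
    (e.add f).Local cst := by
  intro s s' o x y hr hs
  rw [bodyVal_add, bodyVal_add, he _ _ _ _ _ hr hs, hf _ _ _ _ _ hr hs]

theorem Local.sum {l : List (Expr σ P)} (h : ∀ e ∈ l, e.Local cst) : (sum l).Local cst := by
  induction l with
  | nil => exact fun s s' o x y _ _ => rfl
  | cons e l ih => exact Local.add (h e (by simp)) (ih fun f hf => h f (by simp [hf]))

theorem Local.mulProb {q : Diagram σ P ℝ} {e : Expr σ P}
    (hq : ∀ (s s' : State σ O) o, s.rel = s'.rel → q.eval cst s o = q.eval cst s' o)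
    (he : e.Local cst) : (mulProb q e).Local cst := by
  intro s s' o x y hr hs
  rw [bodyVal_mulProb, bodyVal_mulProb, hq _ _ _ hr]
  exact congrArg _ (he _ _ _ _ _ hr hs)

theorem Local.smul (c : ℝ) {e : Expr σ P} (he : e.Local cst) : (smul c e).Local cst := by
  intro s s' o x y hr hs
  rw [bodyVal_smul, bodyVal_smul]
  exact congrArg _ (he _ _ _ _ _ hr hs)

theorem Local.objectMax {m : ℕ} {e : Expr σ (Fin m)} (he : e.Local cst) :
    e.objectMax.Local cst := by
  intro s s' o x y hr hs
  rw [bodyVal_objectMax, bodyVal_objectMax, he _ _ _ _ _ hr hs]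

theorem Local.maxOp {e f : Expr σ P} (he : e.Local cst) (hf : f.Local cst) :
    (e.maxOp f).Local cst := by
  intro s s' o x y hr hs
  rw [bodyVal_maxOp, bodyVal_maxOp, he _ _ _ _ _ hr hs, hf _ _ _ _ _ hr hs]

theorem Local.maxList {l : List (Expr σ P)} (h : ∀ e ∈ l, e.Local cst) :
    (maxList l).Local cst := by
  induction l with
  | nil => exact fun s s' o x y _ _ => rfl
  | cons e l ih =>
    cases l with
    | nil => exact h e (by simp)
    | cons f l => exact Local.maxOp (h e (by simp)) (ih fun g hg => h g (by simp [hg]))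

/-! ### Domination under the operations. -/

theorem Dominated.refl (e : Expr σ P) : e.Dominated cst e :=
  fun _ _ x => ⟨x, fun _ _ _ => le_rfl⟩

theorem Dominated.regress {e f : Expr σ Empty} (h : e.Dominated cst f) {v : Variant σ P}
    (hrel : ∀ (s s' : State σ O) o, s.rel = s'.rel →
      (v.next cst o s).rel = (v.next cst o s').rel) :
    (e.regress v).Dominated cst (f.regress v) := by
  intro r o x
  -- The choice of `sp` as constantly false is arbitrary: by `hrel` the successor's other predicates
  -- depend on `r` and `o` only.
  obtain ⟨x', hx'⟩ := h (v.next cst o ⟨r, fun _ => false⟩).rel Empty.elim x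
  refine ⟨x', fun s hs y => ?_⟩
  have := hx' (v.next cst o s) (hrel _ _ _ hs) y
  exact (bodyVal_regress cst s e v o x y).trans_le
    (this.trans_eq (bodyVal_regress cst s f v o x' y).symm)

theorem Dominated.add {e e' f f' : Expr σ P} (he : e.Dominated cst e') (hf : f.Dominated cst f') :
    (e.add f).Dominated cst (e'.add f') := by
  intro r o x
  obtain ⟨x₁, h₁⟩ := he r o (fun i => x (Fin.castAdd f.k i))
  obtain ⟨x₂, h₂⟩ := hf r o (fun i => x (Fin.natAdd e.k i))
  refine ⟨Fin.append x₁ x₂, fun s hs y => ?_⟩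
  exact (bodyVal_add cst s e f o x y).trans_le
    ((add_le_add (h₁ s hs y) (h₂ s hs y)).trans_eq (bodyVal_add_append ..).symm)

theorem Dominated.sum_map {α : Type} {l : List α} {E F : α → Expr σ P}
    (h : ∀ a ∈ l, (E a).Dominated cst (F a)) :
    (sum (l.map E)).Dominated cst (sum (l.map F)) := by
  induction l with
  | nil => exact Dominated.refl _
  | cons a l ih => exact Dominated.add (h a (by simp)) (ih fun b hb => h b (by simp [hb]))

theorem Dominated.mulProb {q : Diagram σ P ℝ} (hq : ∀ (s : State σ O) o, 0 ≤ q.eval cst s o)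
    {e f : Expr σ P} (h : e.Dominated cst f) :
    (Expr.mulProb q e).Dominated cst (Expr.mulProb q f) := by
  intro r o x
  obtain ⟨x', hx'⟩ := h r o x
  refine ⟨x', fun s hs y => ?_⟩
  exact (bodyVal_mulProb cst s q e o x y).trans_le
    ((mul_le_mul_of_nonneg_left (hx' s hs y) (hq s o)).trans_eq (bodyVal_mulProb ..).symm)

theorem Dominated.smul {c : ℝ} (hc : 0 ≤ c) {e f : Expr σ P} (h : e.Dominated cst f) :
    (Expr.smul c e).Dominated cst (Expr.smul c f) := by
  intro r o x
  obtain ⟨x', hx'⟩ := h r o x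
  refine ⟨x', fun s hs y => ?_⟩
  exact (bodyVal_smul cst s c e o x y).trans_le
    ((mul_le_mul_of_nonneg_left (hx' s hs y) hc).trans_eq (bodyVal_smul ..).symm)

theorem Dominated.objectMax {m : ℕ} {e f : Expr σ (Fin m)} (h : e.Dominated cst f) :
    e.objectMax.Dominated cst f.objectMax := by
  intro r o x
  obtain ⟨x', hx'⟩ := h r (fun i => x (Fin.castAdd e.k i)) (fun i => x (Fin.natAdd m i))
  refine ⟨Fin.append (fun i => x (Fin.castAdd e.k i)) x', fun s hs y => ?_⟩
  exact (bodyVal_objectMax cst s e o x y).trans_le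
    ((hx' s hs y).trans_eq (bodyVal_objectMax_append ..).symm)

/-- Equal selectors pick the left branch. The right branch may be out of reach: over a single object
the selectors cannot differ. -/
theorem dominated_maxOp_left [Nonempty O] (e f : Expr σ P) : e.Dominated cst (e.maxOp f) := by
  intro r o x
  obtain ⟨z, hz⟩ := exists_castLE_eq (le_max_left e.k f.k) x
  obtain ⟨b⟩ := ‹Nonempty O›
  refine ⟨Fin.append (fun _ : Fin 2 => b) z, fun s _ y => ?_⟩
  refine le_of_le_of_eq ?_ (bodyVal_maxOp_append cst s e f o _ z y).symm
  simp only [hz, if_true, le_refl]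

/-- Keeping the two selectors keeps the branch, so only the witness of that branch is needed. -/
theorem Dominated.maxOp [Nonempty O] {e e' f f' : Expr σ P} (he : e.Dominated cst e')
    (hf : f.Dominated cst f') : (e.maxOp f).Dominated cst (e'.maxOp f') := by
  intro r o x
  let c : Fin 2 → O := fun i => x (Fin.castAdd _ i)
  by_cases hx : x (Fin.castAdd _ 0) = x (Fin.castAdd _ 1)
  · obtain ⟨x', hx'⟩ := he r o (fun i => x (Fin.natAdd 2 (Fin.castLE (le_max_left _ _) i)))
    obtain ⟨z, hz⟩ := exists_castLE_eq (le_max_left e'.k f'.k) x'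
    refine ⟨Fin.append c z, fun s hs y => ?_⟩
    refine ((bodyVal_maxOp cst s e f o x y).trans (if_pos hx)).trans_le ((hx' s hs y).trans_eq
      (Eq.symm ((bodyVal_maxOp_append cst s e' f' o c z y).trans ((if_pos hx).trans ?_))))
    simp only [hz]
  · obtain ⟨x', hx'⟩ := hf r o (fun i => x (Fin.natAdd 2 (Fin.castLE (le_max_right _ _) i)))
    obtain ⟨z, hz⟩ := exists_castLE_eq (le_max_right e'.k f'.k) x'
    refine ⟨Fin.append c z, fun s hs y => ?_⟩
    refine ((bodyVal_maxOp cst s e f o x y).trans (if_neg hx)).trans_le ((hx' s hs y).trans_eq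
      (Eq.symm ((bodyVal_maxOp_append cst s e' f' o c z y).trans ((if_neg hx).trans ?_))))
    simp only [hz]

theorem Dominated.maxList_map [Nonempty O] {α : Type} {l : List α} {E F : α → Expr σ P}
    (h : ∀ a ∈ l, (E a).Dominated cst (F a)) :
    (maxList (l.map E)).Dominated cst (maxList (l.map F)) := by
  induction l with
  | nil => exact Dominated.refl _
  | cons a l ih =>
    cases l with
    | nil => exact h a (by simp)
    | cons b l => exact Dominated.maxOp (h a (by simp)) (ih fun c hc => h c (by simp [hc]))

theorem dominated_maxList_cons [Nonempty O] (e : Expr σ P) (l : List (Expr σ P)) :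
    e.Dominated cst (maxList (e :: l)) := by
  cases l with
  | nil => exact Dominated.refl _
  | cons f l => exact dominated_maxOp_left _ _

theorem Dominated.trans {e f g : Expr σ P} (h : e.Dominated cst f) (h' : f.Dominated cst g) :
    e.Dominated cst g := by
  intro r o x
  obtain ⟨x', hx'⟩ := h r o x
  obtain ⟨x'', hx''⟩ := h' r o x'
  exact ⟨x'', fun s hs y => (hx' s hs y).trans (hx'' s hs y)⟩

theorem dominated_add_right [Nonempty O] (e : Expr σ P) {f : Expr σ P} (hf : f.Nonneg cst) :
    e.Dominated cst (e.add f) := by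
  intro r o x
  obtain ⟨b⟩ := ‹Nonempty O›
  refine ⟨Fin.append x (fun _ => b), fun s _ y => ?_⟩
  exact (le_add_of_nonneg_right (hf s o (fun _ => b) y)).trans_eq (bodyVal_add_append ..).symm

theorem Dominated.to_objectMax [Nonempty O] {m : ℕ} {e : Expr σ Empty} {f : Expr σ (Fin m)}
    (h : (e.weaken _).Dominated cst f) : e.Dominated cst f.objectMax := by
  intro r o x
  obtain ⟨b⟩ := ‹Nonempty O›
  obtain ⟨x', hx'⟩ := h r (fun _ => b) x
  refine ⟨Fin.append (fun _ => b) x', fun s hs y => ?_⟩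
  rw [Subsingleton.elim o Empty.elim]
  exact (bodyVal_weaken cst s e (fun _ => b) x y).symm.trans_le
    ((hx' s hs y).trans_eq (bodyVal_objectMax_append ..).symm)

end Pointwise

/-! #### Values of expressions -/

section Values

variable [Fintype O] [DecidableEq O] {cst : σ.Const → O} {s : State σ O}

theorem avg_le_eval (e : Expr σ P) (o : P → O) (x : Fin e.k → O) :
    (∑ y, e.bodyVal cst s o x y) / (Fintype.card O : ℝ) ≤ e.eval cst o s :=
  le_ciSup (f := fun x => (∑ y, e.bodyVal cst s o x y) / (Fintype.card O : ℝ))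
    (Set.finite_range _).bddAbove x

variable [Nonempty O]

theorem eval_le {e : Expr σ P} {o : P → O} {B : ℝ}
    (h : ∀ x, (∑ y, e.bodyVal cst s o x y) / (Fintype.card O : ℝ) ≤ B) : e.eval cst o s ≤ B :=
  ciSup_le h

theorem Dominated.value_le {e f : Expr σ Empty} (h : e.Dominated cst f) :
    e.value cst ≤ f.value cst := by
  intro s
  refine eval_le fun x => ?_
  obtain ⟨x', hx'⟩ := h s.rel Empty.elim x
  refine le_trans ?_ (avg_le_eval f Empty.elim x')
  exact div_le_div_of_nonneg_right (Finset.sum_le_sum fun y _ => hx' s rfl y) (Nat.cast_nonneg _)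

theorem Nonneg.value_nonneg {e : Expr σ Empty} (h : e.Nonneg cst) (s : State σ O) :
    0 ≤ e.value cst s :=
  (div_nonneg (Finset.sum_nonneg fun y _ => h s Empty.elim (fun _ => Classical.arbitrary O) y)
    (Nat.cast_nonneg _)).trans (avg_le_eval e Empty.elim _)

theorem exists_value_le (e : Expr σ Empty) (cst : σ.Const → O) : ∃ B, ∀ s, e.value cst s ≤ B := by
  obtain ⟨B, hB⟩ := Diagram.exists_eval_le cst e.body
  refine ⟨B, fun s => eval_le fun x => ?_⟩
  rw [div_le_iff₀ (by exact_mod_cast Fintype.card_pos)]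
  calc ∑ y, e.bodyVal cst s Empty.elim x y ≤ ∑ _y : O, B := Finset.sum_le_sum fun y _ => hB _ _
    _ = B * Fintype.card O := by simp [mul_comm]

/-! ### Upper bounds for the values of compound expressions. -/

theorem eval_weaken_le (e : Expr σ Empty) (o : P → O) :
    (e.weaken P).eval cst o s ≤ e.value cst s := by
  refine eval_le fun x => ?_
  refine le_of_eq_of_le ?_ (avg_le_eval e Empty.elim x)
  exact congrArg (· / _) (Finset.sum_congr rfl fun y _ => bodyVal_weaken cst s e o x y)

theorem eval_regress_le (e : Expr σ Empty) (v : Variant σ P) (o : P → O) :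
    (e.regress v).eval cst o s ≤ e.value cst (v.next cst o s) := by
  refine eval_le fun x => ?_
  refine le_of_eq_of_le ?_ (avg_le_eval e Empty.elim x)
  exact congrArg (· / _) (Finset.sum_congr rfl fun y _ => bodyVal_regress cst s e v o x y)

theorem eval_add_le (e f : Expr σ P) (o : P → O) :
    (e.add f).eval cst o s ≤ e.eval cst o s + f.eval cst o s := by
  refine eval_le fun x => ?_
  simp only [bodyVal_add, Finset.sum_add_distrib, add_div]
  exact add_le_add (avg_le_eval _ _ _) (avg_le_eval _ _ _)

theorem eval_sum_map_le {α : Type} (l : List α) (E : α → Expr σ P) (o : P → O) (b : α → ℝ)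
    (h : ∀ a ∈ l, (E a).eval cst o s ≤ b a) :
    (sum (l.map E)).eval cst o s ≤ (l.map b).sum := by
  induction l with
  | nil =>
    refine eval_le fun x => ?_
    have : ∀ y, bodyVal cst (sum (List.map E [])) s o x y = 0 := fun _ => rfl
    simp only [this, Finset.sum_const_zero, zero_div, List.map_nil, List.sum_nil, le_refl]
  | cons a l ih =>
    rw [List.map_cons, List.map_cons, List.sum_cons]
    exact (eval_add_le _ _ _).trans
      (add_le_add (h a (by simp)) (ih fun b hb => h b (by simp [hb])))

theorem eval_mulProb_le {q : Diagram σ P ℝ} (e : Expr σ P) {o : P → O}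
    (hq : 0 ≤ q.eval cst s o) :
    (mulProb q e).eval cst o s ≤ q.eval cst s o * e.eval cst o s := by
  refine eval_le fun x => ?_
  simp only [bodyVal_mulProb, ← Finset.mul_sum, mul_div_assoc]
  exact mul_le_mul_of_nonneg_left (avg_le_eval e o x) hq

theorem eval_smul_le {c : ℝ} (hc : 0 ≤ c) (e : Expr σ P) (o : P → O) :
    (smul c e).eval cst o s ≤ c * e.eval cst o s := by
  refine eval_le fun x => ?_
  simp only [bodyVal_smul, ← Finset.mul_sum, mul_div_assoc]
  exact mul_le_mul_of_nonneg_left (avg_le_eval e o x) hc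

theorem value_objectMax_le {m : ℕ} {e : Expr σ (Fin m)} {B : ℝ}
    (h : ∀ o, e.eval cst o s ≤ B) : e.objectMax.value cst s ≤ B := by
  refine eval_le fun x => ?_
  simp only [bodyVal_objectMax]
  exact (avg_le_eval e _ _).trans (h _)

theorem eval_maxOp_le {e f : Expr σ P} {o : P → O} {B : ℝ} (he : e.eval cst o s ≤ B)
    (hf : f.eval cst o s ≤ B) : (e.maxOp f).eval cst o s ≤ B := by
  refine eval_le fun x => ?_
  simp only [bodyVal_maxOp]
  split_ifs
  · exact (avg_le_eval e _ _).trans he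
  · exact (avg_le_eval f _ _).trans hf

theorem eval_maxList_le {l : List (Expr σ P)} (hl : l ≠ []) {o : P → O} {B : ℝ}
    (h : ∀ e ∈ l, e.eval cst o s ≤ B) : (maxList l).eval cst o s ≤ B := by
  induction l with
  | nil => exact absurd rfl hl
  | cons e l ih =>
    cases l with
    | nil => exact h e (by simp)
    | cons f l =>
      exact eval_maxOp_le (h e (by simp)) (ih (by simp) fun g hg => h g (by simp [hg]))

end Values

end Expr

/-! ### Finite sums and product distributions. -/

theorem sum_map_eq_sum_get {α : Type} (l : List α) (f : α → ℝ) :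
    (l.map f).sum = ∑ i : Fin l.length, f (l.get i) := by
  rw [← List.sum_ofFn]
  congr 1
  apply List.ext_get <;> simp

/-- The marginal of a product distribution. -/
theorem sum_prod_mul_eq {ι κ : Type} [Fintype ι] [DecidableEq ι] [Fintype κ] (p : ι → κ → ℝ)
    (hp : ∀ i, ∑ k, p i k = 1) (y : ι) (g : κ → ℝ) :
    ∑ j : ι → κ, (∏ i, p i (j i)) * g (j y) = ∑ k, p y k * g k := by
  -- Absorbing `g (j y)` into the factor at `y` makes the summand a pure product, so the sum
  -- factorizes and every factor other than `y` sums to `1`.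
  have h : ∀ j : ι → κ, (∏ i, p i (j i)) * g (j y) =
      ∏ i, p i (j i) * (if i = y then g (j i) else 1) := by
    intro j
    rw [Finset.prod_mul_distrib, Finset.prod_ite_eq' Finset.univ y (fun i => g (j i))]
    simp
  simp only [h]
  rw [← Fintype.prod_sum (fun i k => p i k * if i = y then g k else 1),
    Finset.prod_eq_single y]
  · simp
  · intro i _ hi
    simp [hi, hp]
  · simp

namespace Domain

/-! ### The template method, pointwise -/

section Template

variable [DecidableEq O] (cst : σ.Const → O)

/-- No variables are renamed apart here, so for fixed `x` and `y` the new formula is the exact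
expectation of `e(x,y)` after the single event `E(y)`. -/
theorem bodyVal_sdp2 (D : Domain σ) (e : Expr σ Empty) (s : State σ O) (o : Empty → O)
    (x : Fin (D.sdp2 e).k → O) (y : O) :
    (D.sdp2 e).bodyVal cst s o x y = (D.event.map fun v =>
      v.prob.eval cst s (fun _ => y) * e.bodyVal cst (v.next cst (fun _ => y) s) o x y).sum := by
  let ζ : GVar e.k → O := fun
    | .a => y
    | .x i => x i
  have hground : ∀ s : State σ O, (ground e).eval cst s ζ = e.bodyVal cst s o x y := by
    intro s
    unfold ground Expr.bodyVal
    rw [Diagram.eval_rename]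
    congr 1
    funext v
    cases v with
    | param p => exact p.elim
    | x i => rfl
    | y => rfl
  have hadd : ∀ l, (addVariants (ground e) l).eval cst s ζ = (l.map fun v =>
      v.prob.eval cst s (fun _ => y) *
        e.bodyVal cst (v.next cst (fun _ => y) s) o x y).sum := by
    intro l
    induction l with
    | nil => rfl
    | cons v l ih =>
      rw [addVariants, Diagram.eval_apply, Diagram.eval_apply, ih, Diagram.eval_rename,
        Variant.eval_regress, hground]
      rfl
  rw [← hadd]
  refine (Diagram.eval_rename cst s _ _ _).trans ?_
  congr 1
  funext v
  cases v <;> rfl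

/-! ### Locality, non-negativity and domination of the iterates. -/

variable {cst} {D : Domain σ}

theorem rel_next_congr (A3 : D.AgentConditionsSpFree) {a : Action σ} (ha : a ∈ D.actions)
    {v : Variant σ (Fin a.arity)} (hv : v ∈ a.variants) (s s' : State σ O) (o : Fin a.arity → O)
    (h : s.rel = s'.rel) : (v.next cst o s).rel = (v.next cst o s').rel := by
  funext p args
  exact Diagram_eval_congr cst s s' _ ∅ h (fun _ ht => ht.elim) _ ((A3 a ha v hv).2.1 p)

theorem sp_next_congr (A3 : D.AgentConditionsSpFree) {a : Action σ} (ha : a ∈ D.actions)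
    {v : Variant σ (Fin a.arity)} (hv : v ∈ a.variants) (s s' : State σ O) (o : Fin a.arity → O)
    (y : O) (h : s.rel = s'.rel) (hy : s.sp y = s'.sp y) :
    (v.next cst o s).sp y = (v.next cst o s').sp y := by
  refine Diagram_eval_congr cst s s' _ _ h ?_ _ (A3 a ha v hv).2.2
  rintro t rfl
  exact hy

theorem prob_eval_congr (A3 : D.AgentConditionsSpFree) {a : Action σ} (ha : a ∈ D.actions)
    {v : Variant σ (Fin a.arity)} (hv : v ∈ a.variants) (s s' : State σ O) (o : Fin a.arity → O)
    (h : s.rel = s'.rel) : v.prob.eval cst s o = v.prob.eval cst s' o :=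
  Diagram_eval_congr cst s s' _ ∅ h (fun _ ht => ht.elim) _ (A3 a ha v hv).1

theorem local_reward (A4 : D.RewardSpOnlyAvg) : D.reward.Local cst := by
  intro s s' o x y h hy
  refine Diagram_eval_congr cst s s' _ _ h ?_ _ A4
  rintro t rfl
  exact hy

theorem local_sdp1 (A3 : D.AgentConditionsSpFree) (A4 : D.RewardSpOnlyAvg) {e : Expr σ Empty}
    (he : e.Local cst) : (D.sdp1 e).Local cst := by
  refine Expr.Local.maxList fun f hf => ?_
  obtain ⟨a, ha, rfl⟩ := List.mem_map.1 hf
  refine ((local_reward A4).weaken.add (.smul _ (.sum fun g hg => ?_))).objectMax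
  obtain ⟨v, hv, rfl⟩ := List.mem_map.1 hg
  exact .mulProb (prob_eval_congr A3 ha hv)
    (he.regress (rel_next_congr A3 ha hv) (sp_next_congr A3 ha hv))

section Nonempty

variable [Fintype O] [Nonempty O]

/-- The event is centred at the averaging variable, so its conditions, like `e(x,y)` itself, read
`sp` only at `y`. -/
theorem local_sdp2 (A1 : D.NonInterfering) (A2 : D.EventsChangeOnlySp) {e : Expr σ Empty}
    (he : e.Local cst) : (D.sdp2 e).Local cst := by
  intro s s' o x y h hy
  rw [bodyVal_sdp2, bodyVal_sdp2]
  congr 1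
  refine List.map_congr_left fun v hv => ?_
  have hp : v.prob.eval cst s (fun _ => y) = v.prob.eval cst s' (fun _ => y) := by
    refine Diagram_eval_congr cst s s' _ _ h ?_ _ (A1 v hv).1
    rintro t rfl
    exact hy
  have hrel : (v.next cst (fun _ => y) s).rel = (v.next cst (fun _ => y) s').rel := by
    rw [(A2 O cst v hv y s).1, (A2 O cst v hv y s').1, h]
  have hsp : (v.next cst (fun _ => y) s).sp y = (v.next cst (fun _ => y) s').sp y := by
    refine Diagram_eval_congr cst s s' _ _ h ?_ _ (A1 v hv).2.2
    -- The two admitted terms are the centre of the event and the argument of `sp`; both denote `y`.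
    rintro t (rfl | rfl) <;> exact hy
  rw [hp]
  exact congrArg _ (he _ _ _ _ _ hrel hsp)

theorem local_iter (A1 : D.NonInterfering) (A2 : D.EventsChangeOnlySp)
    (A3 : D.AgentConditionsSpFree) (A4 : D.RewardSpOnlyAvg) (i : ℕ) : (D.iter i).Local cst := by
  induction i with
  | zero => exact local_reward A4
  | succ i ih => exact local_sdp1 A3 A4 (local_sdp2 A1 A2 ih)

theorem nonneg_reward (hR : D.RewardNonneg) : D.reward.Nonneg cst := by
  intro s o x y
  rw [Subsingleton.elim o Empty.elim]
  exact hR O cst s x y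

theorem nonneg_sdp2 (hD : D.WellFormed) {e : Expr σ Empty} (he : e.Nonneg cst) :
    (D.sdp2 e).Nonneg cst := by
  intro s o x y
  rw [bodyVal_sdp2]
  refine List.sum_nonneg fun r hr => ?_
  obtain ⟨v, hv, rfl⟩ := List.mem_map.1 hr
  exact mul_nonneg ((hD.event_choice O cst s _).1 v hv) (he _ _ _ _)

theorem nonneg_future (hD : D.WellFormed) {e : Expr σ Empty} (he : e.Nonneg cst) {a : Action σ}
    (ha : a ∈ D.actions) :
    (Expr.smul D.discount (.sum (a.variants.map fun v =>
      .mulProb v.prob (e.regress v)))).Nonneg cst := by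
  refine .smul hD.discount_nonneg (.sum fun g hg => ?_)
  obtain ⟨v, hv, rfl⟩ := List.mem_map.1 hg
  exact .mulProb (fun s o => (hD.action_choice a ha O cst s o).1 v hv) (he.regress v)

/-- By A2 all outcomes of all `E(y)` have the same predicates other than `sp`. A witness independent
of `sp` therefore serves every variant and every `y` at once. -/
theorem dominated_sdp2 (hD : D.WellFormed) (A2 : D.EventsChangeOnlySp) {e f : Expr σ Empty}
    (h : e.Dominated cst f) : (D.sdp2 e).Dominated cst (D.sdp2 f) := by
  intro r o x
  obtain ⟨x', hx'⟩ := h r o x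
  refine ⟨x', fun s hs y => ?_⟩
  refine (bodyVal_sdp2 cst D e s o x y).trans_le (le_trans ?_ (bodyVal_sdp2 cst D f s o x' y).ge)
  refine List.sum_le_sum fun v hv => ?_
  exact mul_le_mul_of_nonneg_left (hx' _ ((A2 O cst v hv y s).1.trans hs) y)
    ((hD.event_choice O cst s _).1 v hv)

theorem dominated_sdp1 (hD : D.WellFormed) (A3 : D.AgentConditionsSpFree) {e f : Expr σ Empty}
    (h : e.Dominated cst f) : (D.sdp1 e).Dominated cst (D.sdp1 f) := by
  refine Expr.Dominated.maxList_map fun a ha => ?_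
  refine ((Expr.Dominated.refl _).add (.smul hD.discount_nonneg
    (.sum_map fun v hv => ?_))).objectMax
  exact .mulProb (fun s o => (hD.action_choice a ha O cst s o).1 v hv)
    (h.regress (rel_next_congr A3 ha hv))

/-- `R` is a summand of the `Q`-expression of the first action, the other summand is non-negative,
and the head of the list can always be selected. -/
theorem reward_dominated_sdp1 (hD : D.WellFormed) {e : Expr σ Empty} (he : e.Nonneg cst) :
    D.reward.Dominated cst (D.sdp1 e) := by
  obtain ⟨a, l, hal⟩ := List.exists_cons_of_ne_nil hD.actions_ne
  unfold sdp1
  rw [hal, List.map_cons]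
  refine Expr.Dominated.trans ?_ (Expr.dominated_maxList_cons _ _)
  exact (Expr.dominated_add_right _ (nonneg_future hD he (by simp [hal]))).to_objectMax

theorem iter_dominated_succ (hD : D.WellFormed) (A2 : D.EventsChangeOnlySp)
    (A3 : D.AgentConditionsSpFree) (hR : D.RewardNonneg) (i : ℕ) :
    (D.iter i).Dominated cst (D.iter (i + 1)) := by
  induction i with
  | zero => exact reward_dominated_sdp1 hD (nonneg_sdp2 hD (nonneg_reward hR))
  | succ i ih => exact dominated_sdp1 hD A3 (dominated_sdp2 hD A2 ih)

end Nonempty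

end Template

/-! ### The template method and the Bellman backup -/

section Backup

variable [Fintype O] [DecidableEq O] {D : Domain σ} (cst : σ.Const → O)

/-- Outcomes are indexed by the agent's variant together with one event variant per object; the
event probabilities are read in the intermediate state. -/
theorem expect_mdp (D : Domain σ) (s : State σ O) (a : D.GroundAction O) (f : State σ O → ℝ) :
    (D.mdp cst).expect s a f =
      ∑ q : Fin (D.actions.get a.1).variants.length × (O → Fin D.event.length),
        (((D.actions.get a.1).variants.get q.1).prob.eval cst s a.2 *
          ∏ i, D.eventProb cst i (q.2 i)
            (((D.actions.get a.1).variants.get q.1).next cst a.2 s)) *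
          f (D.simultaneous cst q.2
            (((D.actions.get a.1).variants.get q.1).next cst a.2 s)) := by
  classical
  refine MDP.expect_eq_sum _ s a
    (fun q : Fin (D.actions.get a.1).variants.length × (O → Fin D.event.length) =>
      ((D.actions.get a.1).variants.get q.1).prob.eval cst s a.2 *
        ∏ i, D.eventProb cst i (q.2 i)
          (((D.actions.get a.1).variants.get q.1).next cst a.2 s))
    (fun q => D.simultaneous cst q.2 (((D.actions.get a.1).variants.get q.1).next cst a.2 s)) (fun s' => ?_) f
  simp only [mdp, sum_map_eq_sum_get, exoProb, Finset.mul_sum, Fintype.sum_prod_type, mul_ite,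
    mul_zero]

/-! ### The joint exogenous event and the Bellman backup. -/

variable {cst} [Nonempty O]

theorem sum_eventProb (hD : D.WellFormed) (i : O) (s : State σ O) :
    ∑ j, D.eventProb cst i j s = 1 := by
  rw [← (hD.event_choice O cst s (fun _ => i)).2, sum_map_eq_sum_get]
  rfl

theorem sum_prod_eventProb (hD : D.WellFormed) (s : State σ O) :
    ∑ j : O → Fin D.event.length, ∏ i, D.eventProb cst i (j i) s = 1 := by
  rw [← Fintype.prod_sum (fun i k => D.eventProb cst i k s)]
  simp [sum_eventProb hD]

theorem prod_eventProb_nonneg (hD : D.WellFormed) (s : State σ O)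
    (j : O → Fin D.event.length) : 0 ≤ ∏ i, D.eventProb cst i (j i) s :=
  Finset.prod_nonneg fun _ _ => (hD.event_choice O cst s _).1 _ (List.get_mem _ _)

theorem finitelySupported_mdp (hD : D.WellFormed) : (D.mdp cst).FinitelySupported := by
  intro s a
  have ha := hD.action_choice _ (List.get_mem D.actions a.1) O cst s a.2
  refine ⟨_, inferInstance, _, _, fun q => ?_, ?_, expect_mdp cst D s a⟩
  · exact mul_nonneg (ha.1 _ (List.get_mem _ _)) (prod_eventProb_nonneg hD _ _)
  · simp only [Fintype.sum_prod_type, ← Finset.mul_sum, sum_prod_eventProb hD, mul_one]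
    rw [← ha.2, sum_map_eq_sum_get]

theorem rel_simultaneous (A2 : D.EventsChangeOnlySp) (j : O → Fin D.event.length)
    (s : State σ O) : (D.simultaneous cst j s).rel = s.rel := by
  funext p args
  have : ¬ ∃ i, (D.eventNext cst i (j i) s).rel p args ≠ s.rel p args := by
    rintro ⟨i, hi⟩
    exact hi (by rw [eventNext, (A2 O cst _ (List.get_mem _ _) i s).1])
  simp [simultaneous, this]

/-- Only the event centred at `y` can flip `sp(y)`, so the existential over centres reduces to `y`.
-/
theorem sp_simultaneous (A2 : D.EventsChangeOnlySp) (j : O → Fin D.event.length)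
    (s : State σ O) (y : O) :
    (D.simultaneous cst j s).sp y = (D.eventNext cst y (j y) s).sp y := by
  have hex : (∃ i, (D.eventNext cst i (j i) s).sp y ≠ s.sp y) ↔
      (D.eventNext cst y (j y) s).sp y ≠ s.sp y := by
    refine ⟨?_, fun h => ⟨y, h⟩⟩
    rintro ⟨i, h⟩
    by_cases hy : y = i
    · subst hy
      exact h
    · exact absurd ((A2 O cst _ (List.get_mem _ _) i s).2 y hy) h
  simp only [simultaneous, hex]
  cases (D.eventNext cst y (j y) s).sp y <;> cases s.sp y <;> simp

/-- `SDP²` is a lower bound for the expectation over the joint exogenous events. -/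
theorem value_sdp2_le (hD : D.WellFormed) (A2 : D.EventsChangeOnlySp) {e : Expr σ Empty}
    (he : e.Local cst) (s : State σ O) :
    (D.sdp2 e).value cst s ≤ ∑ j : O → Fin D.event.length,
      (∏ i, D.eventProb cst i (j i) s) * e.value cst (D.simultaneous cst j s) := by
  refine Expr.eval_le fun x => ?_
  have hy : ∀ y, (D.sdp2 e).bodyVal cst s Empty.elim x y = ∑ j : O → Fin D.event.length,
      (∏ i, D.eventProb cst i (j i) s) *
        e.bodyVal cst (D.simultaneous cst j s) Empty.elim x y := by
    intro y
    -- The joint outcome and the outcome of `E(y)` alone agree on all that a local formula sees: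
    -- `sp(y)` and the other predicates.
    have hloc : ∀ j : O → Fin D.event.length,
        e.bodyVal cst (D.simultaneous cst j s) Empty.elim x y =
          e.bodyVal cst (D.eventNext cst y (j y) s) Empty.elim x y := fun j =>
      he _ _ _ _ _ ((rel_simultaneous A2 j s).trans (A2 O cst _ (List.get_mem _ _) y s).1.symm)
        (sp_simultaneous A2 j s y)
    rw [bodyVal_sdp2, sum_map_eq_sum_get]
    refine Eq.symm ((Finset.sum_congr rfl fun j _ => congrArg _ (hloc j)).trans ?_)
    exact sum_prod_mul_eq (fun i k => D.eventProb cst i k s) (fun i => sum_eventProb hD i s) y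
      (fun k => e.bodyVal cst (D.eventNext cst y k s) Empty.elim x y)
  simp only [hy]
  rw [Finset.sum_comm, Finset.sum_div]
  -- The inequality enters here: `x` is fixed before `j` is drawn, whereas the value in each outcome
  -- may use its own best `x`.
  refine Finset.sum_le_sum fun j _ => ?_
  rw [← Finset.mul_sum, mul_div_assoc]
  exact mul_le_mul_of_nonneg_left (Expr.avg_le_eval e Empty.elim x)
    (prod_eventProb_nonneg hD s j)

theorem value_approxBackup_le_bellman (hD : D.WellFormed) (A2 : D.EventsChangeOnlySp)
    {e : Expr σ Empty} (he : e.Local cst) :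
    (D.approxBackup e).value cst ≤ (D.mdp cst).bellman (e.value cst) := by
  intro s
  refine Expr.eval_maxList_le (by simpa using hD.actions_ne) fun f hf => ?_
  obtain ⟨a, ha, rfl⟩ := List.mem_map.1 hf
  obtain ⟨n, rfl⟩ := List.get_of_mem ha
  refine Expr.value_objectMax_le fun o => ?_
  -- The template with its parameters instantiated by `o` is one of the ground actions over which
  -- the Bellman backup maximizes.
  refine le_trans ?_ (le_ciSup (f := fun a : D.GroundAction O => (D.mdp cst).reward s +
    (D.mdp cst).discount * (D.mdp cst).expect s a (e.value cst))
    (Set.finite_range _).bddAbove ⟨n, o⟩)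
  refine (Expr.eval_add_le _ _ _).trans (add_le_add (Expr.eval_weaken_le _ _) ?_)
  refine (Expr.eval_smul_le hD.discount_nonneg _ _).trans
    (mul_le_mul_of_nonneg_left ?_ hD.discount_nonneg)
  rw [expect_mdp, Fintype.sum_prod_type]
  simp only [mul_assoc, ← Finset.mul_sum]
  refine (Expr.eval_sum_map_le _ _ o (fun v => v.prob.eval cst s o *
    ∑ j : O → Fin D.event.length, (∏ i, D.eventProb cst i (j i) (v.next cst o s)) *
      e.value cst (D.simultaneous cst j (v.next cst o s))) fun v hv => ?_).trans
    (sum_map_eq_sum_get _ _).le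
  have hp := (hD.action_choice _ ha O cst s o).1 v hv
  refine (Expr.eval_mulProb_le _ hp).trans (mul_le_mul_of_nonneg_left ?_ hp)
  exact (Expr.eval_regress_le _ v o).trans (value_sdp2_le hD A2 he _)

end Backup

end Domain

end ServiceDomains

theorem theorem1 {σ : ServiceDomains.Signature} (D : ServiceDomains.Domain σ)
    (hD : D.WellFormed) (A1 : D.NonInterfering) (A2 : D.EventsChangeOnlySp)
    (A3 : D.AgentConditionsSpFree) (A4 : D.RewardSpOnlyAvg) (hR : D.RewardNonneg)
    (O : Type) [Fintype O] [DecidableEq O] [Nonempty O] (cst : σ.Const → O) (i : ℕ) :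
    (D.iter i).value cst ≤ (D.iter (i + 1)).value cst ∧
    D.iter (i + 1) = D.approxBackup (D.iter i) ∧
    (D.approxBackup (D.iter i)).value cst ≤ (D.mdp cst).bellman ((D.iter i).value cst) ∧
    (D.mdp cst).bellman ((D.iter i).value cst) ≤ (D.mdp cst).optimalValue := by
  have hmono : (D.iter i).value cst ≤ (D.iter (i + 1)).value cst :=
    (ServiceDomains.Domain.iter_dominated_succ hD A2 A3 hR i).value_le
  have hback : (D.approxBackup (D.iter i)).value cst ≤
      (D.mdp cst).bellman ((D.iter i).value cst) :=
    ServiceDomains.Domain.value_approxBackup_le_bellman hD A2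
      (ServiceDomains.Domain.local_iter A1 A2 A3 A4 i)
  refine ⟨hmono, rfl, hback, ?_⟩
  -- With infinitely many predicates the state space is infinite; uniform bounds still exist because
  -- a diagram has finitely many leaves.
  obtain ⟨B, hB⟩ := D.reward.exists_value_le cst
  obtain ⟨C, hC⟩ := (D.iter i).exists_value_le cst
  have : Nonempty (D.GroundAction O) :=
    ⟨⟨⟨0, List.length_pos_of_ne_nil hD.actions_ne⟩, fun _ => Classical.arbitrary O⟩⟩
  exact (ServiceDomains.Domain.finitelySupported_mdp hD).bellman_le_optimalValue
    hD.discount_nonneg hD.discount_lt_one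
    (ServiceDomains.Domain.nonneg_reward hR).value_nonneg hB hC (hmono.trans hback)
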